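/- Conventions. Model categories have all small limits and colimits and functorial factorizations. For a small category $C$, a subcategory $D\subset C$ and a cofibrantly generated model category $S$, the *$D$-relative model structure* on $S^C$ is the model structure whose weak equivalences (resp. fibrations) are the *$D$-weak equivalences* (resp. *$D$-fibrations*), i.e. the morphisms $\varphi$ such that $\varphi(d)$ is a weak equivalence (resp. a fibration) in $S$ for every object $d$ of $D$; write $U_S(C,D)$ for it. (It depends only on the objects of $D$, and its existence is part of the statement.) A functor $\odot\colon S_1\times S_2\to S_3$ is a *right tensorial coupling* if there is a functor $R\colon S_2^{\rm op}\times S_3\to S_1$ with bijections $\mathrm{mor}_{S_3}(x\odot y,z)\cong \mathrm{mor}_{S_1}(x,R(y,z))$ natural in $x,y,z$. If the $S_i$ are model categories, it has the *corner-map property* if for every cofibration $i\colon y\to y'$ in $S_2$ and every fibration $p\colon z\to z'$ in $S_3$ the induced map $R(y',z)\to R(y,z)\times_{R(y,z')}R(y',z')$ is a fibration, and a trivial fibration if moreover $i$ or $p$ is a weak equivalence. For small categories $A$ and $C$, for $X\in S_1^{A^{\rm op}\times C}$ and $Y\in S_2^A$, the diagram $X\otimes_{C,A}Y\in S_3^C$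 is given by $$(X\otimes_{C,A}Y)(c)=\mathrm{coeq}\Big(\coprod_{\alpha\colon b\to b'\text{ in }A}X(b',c)\odot Y(b)\rightrightarrows\coprod_{a\in A}X(a,c)\odot Y(a)\Big),$$ where the two maps are induced by $X(\alpha,c)\odot Y(b)$ and by $X(b',c)\odot Y(\alpha)$. **Theorem.** Let $S_1,S_2,S_3$ be cofibrantly generated model categories and let $\odot\colon S_1\times S_2\to S_3$ be a right tensorial coupling with the corner-map property such that $x\odot\varnothing$ is an initial object of $S_3$ for every $x\in S_1$, where $\varnothing$ is the initial object of $S_2$. Let $A$ and $C$ be small categories, and $D$ a subcategory of $C$. Let $Y\in S_2^A$ be objectwise cofibrant. Then the relative model structures below exist and there is a Quillen adjunction $$(-)\otimes_{C,A}Y\colon\ U_{S_1}(A^{\rm op}\times C,\,A^{\rm op}\times D)\ \rightleftarrows\ U_{S_3}(C,D)\ :\!R_\otimes(Y,-),\qquad R_\otimes(Y,Z)(a,c)=R(Y(a),Z(c)).$$ In particular, $(-)\otimes_{C,A}Y$ takes $A^{\rm op}\times D$-weak equivalences between cofibrant objects of $U_{S_1}(A^{\rm op}\times C,A^{\rm op}\times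 D)$ to $D$-weak equivalences between cofibrant objects of $U_{S_3}(C,D)$. -/

import Mathlib

open CategoryTheory Limits HomotopicalAlgebra Opposite

universe w u₁ u₂ u₃ u

namespace DiagramCoupling

/-- A model category is cofibrantly generated if there are small sets `I` and `J` of morphisms,
both permitting the small object argument, such that the trivial fibrations are the morphisms with
the right lifting property with respect to `I`, and the fibrations are the morphisms with the right
lifting property with respect to `J`. (The smallness of `I` and `J` is part of
`MorphismProperty.HasSmallObjectArgument`.) -/
def IsCofibrantlyGenerated (S : Type u) [Category.{w} S] [ModelCategory S] : Prop :=
  ∃ I J : MorphismProperty S,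
    MorphismProperty.HasSmallObjectArgument.{w} I ∧
    MorphismProperty.HasSmallObjectArgument.{w} J ∧
    trivialFibrations S = I.rlp ∧ fibrations S = J.rlp

section Relative

variable {S : Type u} [Category.{w} S] [ModelCategory S] {C : Type w} [SmallCategory C]

/-- The `D`-weak equivalences in `S^C`: the morphisms `φ` such that `φ(d)` is a weak equivalence for
every object `d` of `D`. A subcategory `D` of `C` enters here, and in all that follows, only through
its class of objects, an arbitrary `ObjectProperty C`. -/
def relWeakEquivalences (S : Type u) [Category.{w} S] [ModelCategory S]
    (D : ObjectProperty C) : MorphismProperty (C ⥤ S) :=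
  fun _ _ φ => ∀ d : C, D d → WeakEquivalence (φ.app d)

/-- The `D`-fibrations in `S^C`: the morphisms `φ` such that `φ(d)` is a fibration for every
object `d` of `D`. -/
def relFibrations (S : Type u) [Category.{w} S] [ModelCategory S]
    (D : ObjectProperty C) : MorphismProperty (C ⥤ S) :=
  fun _ _ φ => ∀ d : C, D d → Fibration (φ.app d)

/-- `M` is the `D`-relative model structure on `S^C`: its weak equivalences are the `D`-weak
equivalences and its fibrations are the `D`-fibrations (so that its cofibrations are determined by
the left lifting property). As in the convention that the factorizations of a model category
can be chosen functorially, both factorization axioms are required in their functorial form. -/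
structure IsRelativeModelStructure (M : ModelCategory (C ⥤ S)) (D : ObjectProperty C) :
    Prop where
  weakEquivalences_eq : weakEquivalences (C ⥤ S) = relWeakEquivalences S D
  fibrations_eq : fibrations (C ⥤ S) = relFibrations S D
  functorial_factorization₁ : MorphismProperty.HasFunctorialFactorization
    (trivialCofibrations (C ⥤ S)) (fibrations (C ⥤ S))
  functorial_factorization₂ : MorphismProperty.HasFunctorialFactorization
    (cofibrations (C ⥤ S)) (trivialFibrations (C ⥤ S))

/-- The objects of the subcategory `A^op × D` of `A^op × C`. -/
def opProd (A : Type w) [SmallCategory A] (D : ObjectProperty C) : ObjectProperty (Aᵒᵖ × C) :=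
  fun x => D x.2

end Relative

/-- A Quillen adjunction between model categories: an adjunction `F ⊣ G` such that `F` preserves
cofibrations and trivial cofibrations and `G` preserves fibrations and trivial fibrations. -/
structure IsQuillenAdjunction {M : Type u₁} {N : Type u₂} [Category.{w} M] [Category.{w} N]
    [ModelCategory M] [ModelCategory N] {F : M ⥤ N} {G : N ⥤ M} (_adj : F ⊣ G) : Prop where
  map_cofibration : ∀ ⦃X Y : M⦄ (f : X ⟶ Y), cofibrations M f → cofibrations N (F.map f)
  map_trivialCofibration : ∀ ⦃X Y : M⦄ (f : X ⟶ Y),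
    trivialCofibrations M f → trivialCofibrations N (F.map f)
  map_fibration : ∀ ⦃X Y : N⦄ (f : X ⟶ Y), fibrations N f → fibrations M (G.map f)
  map_trivialFibration : ∀ ⦃X Y : N⦄ (f : X ⟶ Y),
    trivialFibrations N f → trivialFibrations M (G.map f)

section Coupling

variable {S₁ : Type u₁} {S₂ : Type u₂} {S₃ : Type u₃}
  [Category.{w} S₁] [Category.{w} S₂] [Category.{w} S₃]

/-- The corner-map property, for the right mapping functor `R` of a right tensorial coupling: for
every cofibration `i : y ⟶ y'` in `S₂` and every fibration `p : z ⟶ z'` in `S₃`, the corner map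
`R(y', z) ⟶ R(y, z) ×_{R(y, z')} R(y', z')` is a fibration in `S₁`, and it is a trivial fibration if
moreover `i` or `p` is a weak equivalence. -/
def CornerMapProperty [ModelCategory S₁] [ModelCategory S₂] [ModelCategory S₃]
    (R : S₂ᵒᵖ ⥤ S₃ ⥤ S₁) : Prop :=
  ∀ ⦃y y' : S₂⦄ (i : y ⟶ y') ⦃z z' : S₃⦄ (p : z ⟶ z'),
    cofibrations S₂ i → fibrations S₃ p →
      fibrations S₁ (Functor.PullbackObjObj.ofHasPullback R i p).π ∧
      (weakEquivalences S₂ i ∨ weakEquivalences S₃ p →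
        trivialFibrations S₁ (Functor.PullbackObjObj.ofHasPullback R i p).π)

variable {A : Type w} [SmallCategory A] {C : Type w} [SmallCategory C]

section Tensor

variable [HasColimits S₃] (T : S₁ ⥤ S₂ ⥤ S₃) (Y : A ⥤ S₂)

/-- The coproduct of the `X(b') ⊙ Y(b)` over all the morphisms `α : b ⟶ b'` of `A`. -/
noncomputable abbrev arrowCoprod (X : Aᵒᵖ ⥤ S₁) : S₃ :=
  ∐ fun α : Arrow A => (T.obj (X.obj (op α.right))).obj (Y.obj α.left)

/-- The coproduct of the `X(a) ⊙ Y(a)` over all the objects `a` of `A`. -/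
noncomputable abbrev objCoprod (X : Aᵒᵖ ⥤ S₁) : S₃ :=
  ∐ fun a : A => (T.obj (X.obj (op a))).obj (Y.obj a)

/-- On the summand of `α : b ⟶ b'`, this is `X(α) ⊙ Y(b)` followed by the inclusion of the
summand of `b`. -/
noncomputable def actLeft (X : Aᵒᵖ ⥤ S₁) : arrowCoprod T Y X ⟶ objCoprod T Y X :=
  Sigma.desc fun α : Arrow A => (T.map (X.map α.hom.op)).app (Y.obj α.left) ≫
    Sigma.ι (fun a : A => (T.obj (X.obj (op a))).obj (Y.obj a)) α.left

/-- On the summand of `α : b ⟶ b'`, this is `X(b') ⊙ Y(α)` followed by the inclusion of the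
summand of `b'`. -/
noncomputable def actRight (X : Aᵒᵖ ⥤ S₁) : arrowCoprod T Y X ⟶ objCoprod T Y X :=
  Sigma.desc fun α : Arrow A => (T.obj (X.obj (op α.right))).map (Y.map α.hom) ≫
    Sigma.ι (fun a : A => (T.obj (X.obj (op a))).obj (Y.obj a)) α.right

/-- The map induced by `τ : X ⟶ X'` on the coproducts over the morphisms of `A`. -/
noncomputable def arrowCoprodMap {X X' : Aᵒᵖ ⥤ S₁} (τ : X ⟶ X') :
    arrowCoprod T Y X ⟶ arrowCoprod T Y X' :=
  Limits.Sigma.map fun α : Arrow A => (T.map (τ.app (op α.right))).app (Y.obj α.left)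

/-- The map induced by `τ : X ⟶ X'` on the coproducts over the objects of `A`. -/
noncomputable def objCoprodMap {X X' : Aᵒᵖ ⥤ S₁} (τ : X ⟶ X') :
    objCoprod T Y X ⟶ objCoprod T Y X' :=
  Limits.Sigma.map fun a : A => (T.map (τ.app (op a))).app (Y.obj a)

lemma actLeft_comp {X X' : Aᵒᵖ ⥤ S₁} (τ : X ⟶ X') :
    actLeft T Y X ≫ objCoprodMap T Y τ = arrowCoprodMap T Y τ ≫ actLeft T Y X' := by
  apply Sigma.hom_ext
  intro α
  have h : X.map α.hom.op ≫ τ.app (op α.left) = τ.app (op α.right) ≫ X'.map α.hom.op :=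
    τ.naturality α.hom.op
  simp [actLeft, objCoprodMap, arrowCoprodMap, ← NatTrans.comp_app_assoc, ← Functor.map_comp, h]

lemma actRight_comp {X X' : Aᵒᵖ ⥤ S₁} (τ : X ⟶ X') :
    actRight T Y X ≫ objCoprodMap T Y τ = arrowCoprodMap T Y τ ≫ actRight T Y X' := by
  apply Sigma.hom_ext
  intro α
  simp [actRight, objCoprodMap, arrowCoprodMap]

/-- The functor `(-) ⊗_A Y : S₁^(A^op) ⥤ S₃`, where `X ⊗_A Y` is the coequalizer of the two maps
`∐_{α : b ⟶ b'} X(b') ⊙ Y(b) ⇉ ∐_a X(a) ⊙ Y(a)`. -/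
noncomputable def tensorOver : (Aᵒᵖ ⥤ S₁) ⥤ S₃ where
  obj X := coequalizer (actLeft T Y X) (actRight T Y X)
  map {X X'} τ := coequalizer.desc
    (objCoprodMap T Y τ ≫ coequalizer.π (actLeft T Y X') (actRight T Y X')) (by
      rw [← Category.assoc, ← Category.assoc, actLeft_comp, actRight_comp, Category.assoc,
        Category.assoc, coequalizer.condition])
  map_id X := by
    apply coequalizer.hom_ext
    have : objCoprodMap T Y (𝟙 X) = 𝟙 _ := by
      apply Sigma.hom_ext
      intro a
      simp [objCoprodMap]
    simp [this]
  map_comp {X X' X''} τ τ' := by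
    apply coequalizer.hom_ext
    have : objCoprodMap T Y (τ ≫ τ') = objCoprodMap T Y τ ≫ objCoprodMap T Y τ' := by
      apply Sigma.hom_ext
      intro a
      simp [objCoprodMap]
    simp [this]

/-- The functor `(-) ⊗_{C,A} Y : S₁^(A^op × C) ⥤ S₃^C` (the bi-tensor product with `Y`), given by
`(X ⊗_{C,A} Y)(c) = X(-, c) ⊗_A Y`. -/
noncomputable def biTensor : (Aᵒᵖ × C ⥤ S₁) ⥤ (C ⥤ S₃) :=
  Functor.curry ⋙ flipFunctor Aᵒᵖ C S₁ ⋙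
    (Functor.whiskeringRight C (Aᵒᵖ ⥤ S₁) S₃).obj (tensorOver T Y)

end Tensor

/-- The functor `S₃^C ⥤ S₁^(A^op × C)` that sends `Z` to the diagram `(a, c) ↦ R(Y(a), Z(c))`. -/
def biMap (R : S₂ᵒᵖ ⥤ S₃ ⥤ S₁) (Y : A ⥤ S₂) : (C ⥤ S₃) ⥤ (Aᵒᵖ × C ⥤ S₁) where
  obj Z :=
    { obj := fun x => (R.obj (op (Y.obj x.1.unop))).obj (Z.obj x.2)
      map := fun {x x'} f => (R.map (Y.map f.1.unop).op).app (Z.obj x.2) ≫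
        (R.obj (op (Y.obj x'.1.unop))).map (Z.map f.2) }
  map {Z Z'} q :=
    { app := fun x => (R.obj (op (Y.obj x.1.unop))).map (q.app x.2)
      naturality := fun x x' f => by
        have h : Z.map f.2 ≫ q.app x'.2 = q.app x.2 ≫ Z'.map f.2 := q.naturality f.2
        simp [← Functor.map_comp, h] }

end Coupling

end DiagramCoupling

/-!
The relative model structure on `S^C` is generated by the morphisms `C(d, -) ⊗ i`, for `d` in `D` and
`i` a generating cofibration or a generating trivial cofibration of `S`. By the adjunction between
`x ↦ C(d, -) ⊗ x` and evaluation at `d`, having the right lifting property against these means being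
a trivial fibration, or a fibration, at the objects of `D` (`rlp_freeCells`). The small object
argument applies to them because evaluating a relative cell complex at an object gives a relative
cell complex for the generators of `S` (`hasSmallObjectArgument_freeCells`). The remaining condition
of the recognition theorem `exists_modelCategory`, that the relative trivial cofibrations are
`D`-weak equivalences, needs no analysis of cell complexes: each evaluation functor also has a right
adjoint, and this right adjoint preserves fibrations (`llp_relFibrations_app`).

A map `X ⊗_A Y ⟶ z` is a dinatural family of maps `X(a) ⊙ Y(a) ⟶ z`, which is the same as a natural
family of maps `X(a) ⟶ R(Y(a), z)`; applied over every object of `C`, this gives the adjunction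
(`biTensorAdjunction`). Its right adjoint `Z ↦ R(Y(-), Z(-))` preserves relative fibrations and
relative trivial fibrations: since `x ⊙ ∅` is always initial, `R(∅, z)` is always terminal, so the
corner map of `∅ ⟶ Y(a)` and `p` is isomorphic to `R(Y(a), p)` (`pullbackObjObj_π_iff`), and `Y(a)`
is cofibrant. Hence the adjunction is a Quillen adjunction, and the statement on weak equivalences
between cofibrant objects is Ken Brown's lemma.
-/

namespace DiagramCoupling

/-! ### Free cells in diagram categories -/

section Cells

variable {S : Type u} [Category.{w} S] [HasColimits S] {C : Type w} [SmallCategory C]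

/-- The morphisms `C(d, -) ⊗ i`, the images of the `i` in `I` under the left adjoint
`x ↦ ∐_{C(d, -)} x` of the evaluation at `d`, for `d` in `D`. For `I` a set of generating
(trivial) cofibrations of `S`, they generate the (trivial) cofibrations of the `D`-relative model
structure. -/
def freeCells (I : MorphismProperty S) (D : ObjectProperty C) : MorphismProperty (C ⥤ S) :=
  .ofHoms fun x : { d : C // D d } × I.toSet => (evaluationLeftAdjoint S x.1.1).map x.2.1.hom

lemma rlp_freeCells (I : MorphismProperty S) (D : ObjectProperty C) {F G : C ⥤ S} (p : F ⟶ G) :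
    (freeCells I D).rlp p ↔ ∀ d : C, D d → I.rlp (p.app d) := by
  constructor
  · intro h d hd A B i hi
    exact ((evaluationAdjunctionRight S d).hasLiftingProperty_iff i p).1
      (h _ (MorphismProperty.ofHoms.mk (f := fun x : { d : C // D d } × I.toSet =>
        (evaluationLeftAdjoint S x.1.1).map x.2.1.hom) (⟨d, hd⟩, ⟨Arrow.mk i, hi⟩)))
  · rintro h _ _ _ ⟨⟨⟨d, hd⟩, ⟨i, hi⟩⟩⟩
    exact ((evaluationAdjunctionRight S d).hasLiftingProperty_iff i.hom p).2 (h d hd _ hi)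

/-- A coproduct of functors, evaluated at an object, is a coproduct. -/
noncomputable def isColimitCofanApp {α : Type w} {X : α → C ⥤ S} {c : Cofan X} (hc : IsColimit c)
    (d : C) : IsColimit (Cofan.mk (c.pt.obj d) fun k => (c.inj k).app d) :=
  isColimitCofanMkObjOfIsColimit ((evaluation C S).obj d) X c.inj
    (hc.ofIsoColimit (Cofan.ext (Iso.refl _)))

/-- Evaluating a cell attachment at `d` attaches, for each cell of type `C(c, -) ⊗ i`, one cell of
type `i` for every morphism `c ⟶ d`. -/
lemma nonempty_attachCells_app {I : MorphismProperty S} {D : ObjectProperty C} {F G : C ⥤ S}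
    {φ : F ⟶ G} (a : AttachCells.{w} (freeCells I D).homFamily φ) (d : C) :
    Nonempty (AttachCells.{w} I.homFamily (φ.app d)) := by
  obtain ⟨a⟩ : Nonempty (AttachCells.{w} (fun x : { d : C // D d } × I.toSet =>
      (evaluationLeftAdjoint S x.1.1).map x.2.1.hom) φ) := by
    rw [nonempty_attachCells_iff]
    have h := a.pushouts_coproducts
    rwa [MorphismProperty.ofHoms_homFamily] at h
  let ev := (evaluation C S).obj d
  refine ⟨{
    ι := Σ k : a.ι, ((a.π k).1.1 ⟶ d)
    π x := (a.π x.1).2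
    cofan₁ := Cofan.mk (a.cofan₁.pt.obj d) fun x =>
      Sigma.ι (fun _ : (a.π x.1).1.1 ⟶ d => (a.π x.1).2.1.left) x.2 ≫ (a.cofan₁.inj x.1).app d
    cofan₂ := Cofan.mk (a.cofan₂.pt.obj d) fun x =>
      Sigma.ι (fun _ : (a.π x.1).1.1 ⟶ d => (a.π x.1).2.1.right) x.2 ≫ (a.cofan₂.inj x.1).app d
    isColimit₁ := Cofan.isColimitTrans _ (isColimitCofanApp a.isColimit₁ d)
      (fun k => Sigma.ι fun _ : (a.π k).1.1 ⟶ d => (a.π k).2.1.left)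
      (fun k => coproductIsCoproduct _)
    isColimit₂ := Cofan.isColimitTrans _ (isColimitCofanApp a.isColimit₂ d)
      (fun k => Sigma.ι fun _ : (a.π k).1.1 ⟶ d => (a.π k).2.1.right)
      (fun k => coproductIsCoproduct _)
    m := a.m.app d
    hm := ?_
    g₁ := a.g₁.app d
    g₂ := a.g₂.app d
    isPushout := a.isPushout.map ev }⟩
  rintro ⟨k, g⟩
  have h : (a.cofan₁.inj k).app d ≫ a.m.app d =
      ((evaluationLeftAdjoint S (a.π k).1.1).map (a.π k).2.1.hom).app d ≫
        (a.cofan₂.inj k).app d :=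
    NatTrans.congr_app (a.hm k) d
  have h' : Sigma.ι (fun _ : (a.π k).1.1 ⟶ d => (a.π k).2.1.left) g ≫
      ((evaluationLeftAdjoint S (a.π k).1.1).map (a.π k).2.1.hom).app d =
        (a.π k).2.1.hom ≫ Sigma.ι (fun _ : (a.π k).1.1 ⟶ d => (a.π k).2.1.right) g :=
    Sigma.ι_desc _ g
  exact (Category.assoc _ _ _).trans ((congrArg _ h).trans ((Category.assoc _ _ _).symm.trans
    ((congrArg (· ≫ _) h').trans (Category.assoc _ _ _))))

instance isSmall_freeCells (I : MorphismProperty S) [MorphismProperty.IsSmall.{w} I]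
    (D : ObjectProperty C) : MorphismProperty.IsSmall.{w} (freeCells I D) := by
  unfold freeCells
  infer_instance

/-- The domains of `freeCells I D` are small because a morphism from `C(d, -) ⊗ x` to `F` is a
morphism from `x` to `F(d)`, and relative `freeCells I D`-cell complexes evaluate to relative
`I`-cell complexes. -/
lemma hasSmallObjectArgument_freeCells (I : MorphismProperty S)
    (hI : MorphismProperty.HasSmallObjectArgument.{w} I) (D : ObjectProperty C) :
    MorphismProperty.HasSmallObjectArgument.{w} (freeCells I D) := by
  obtain ⟨κ, hκ, hbot, h⟩ := hI.exists_cardinal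
  have := h.isSmall
  refine ⟨κ, hκ, hbot, { preservesColimit := ?_ }⟩
  rintro _ _ F G _ ⟨⟨⟨d, hd⟩, ⟨i, hi⟩⟩⟩ φ c
  let ev := (evaluation C S).obj d
  let c' : RelativeCellComplex.{w} (fun _ : κ.ord.ToType => I.homFamily) (φ.app d) :=
    { toTransfiniteCompositionOfShape := c.toTransfiniteCompositionOfShape.map ev
      attachCells j hj := (nonempty_attachCells_app (c.attachCells j hj) d).some }
  have : PreservesColimit (c.F ⋙ ev) (coyoneda.obj (op i.left)) :=
    h.preservesColimit i.hom hi (φ.app d) c'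
  let e : ev ⋙ coyoneda.obj (op i.left) ≅
      coyoneda.obj (op ((evaluationLeftAdjoint S d).obj i.left)) :=
    NatIso.ofComponents
      (fun H => (((evaluationAdjunctionRight S d).homEquiv i.left H).symm).toIso)
      (fun {H H'} f => by
        ext g
        exact (evaluationAdjunctionRight S d).homEquiv_naturality_right_symm g f)
  exact preservesColimit_of_natIso _ e

end Cells

/-! ### Relative model structures -/

section Existence

variable {E : Type u} [Category.{w} E] [HasFiniteLimits E] [HasFiniteColimits E]

/-- A form of Kan's recognition theorem for cofibrantly generated model structures. -/
theorem exists_modelCategory (W I J : MorphismProperty E) [W.HasTwoOutOfThreeProperty]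
    [MorphismProperty.HasFunctorialFactorization I.rlp.llp I.rlp]
    [MorphismProperty.HasFunctorialFactorization J.rlp.llp J.rlp]
    (hIJ : I.rlp = J.rlp ⊓ W) (hJ : J.rlp.llp ≤ W) :
    ∃ _ : ModelCategory E, weakEquivalences E = W ∧ fibrations E = J.rlp ∧
      (trivialCofibrations E).HasFunctorialFactorization (fibrations E) ∧
      (cofibrations E).HasFunctorialFactorization (trivialFibrations E) := by
  let _ : CategoryWithFibrations E := ⟨J.rlp⟩
  let _ : CategoryWithCofibrations E := ⟨I.rlp.llp⟩
  let _ : CategoryWithWeakEquivalences E := ⟨W⟩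
  have htf : trivialFibrations E = I.rlp := hIJ.symm
  have htc : trivialCofibrations E = J.rlp.llp := by
    apply le_antisymm
    · rintro A B f ⟨hf, hw⟩
      -- The retract argument: in a factorization `f = i ≫ p` with `i` in `J.rlp.llp` and `p` in
      -- `J.rlp`, the map `p` lies in `W` by two-out-of-three, hence in `I.rlp`, so that `f` lifts
      -- against `p`.
      let φ := MorphismProperty.factorizationData J.rlp.llp J.rlp f
      have hp : I.rlp φ.p := by
        rw [hIJ]
        exact ⟨φ.hp, W.of_precomp φ.i φ.p (hJ _ φ.hi) (by rwa [φ.fac])⟩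
      have := hf _ hp
      exact MorphismProperty.of_retract (RetractArrow.ofLeftLiftingProperty φ.fac) φ.hi
    · intro A B f hf
      refine ⟨fun _ _ p hp => ?_, hJ _ hf⟩
      rw [hIJ] at hp
      exact hf _ hp.1
  have : MorphismProperty.IsWeakFactorizationSystem (cofibrations E) (trivialFibrations E) := by
    rw [htf]
    exact ⟨MorphismProperty.rlp_llp_rlp _, rfl,
      inferInstanceAs (MorphismProperty.HasFactorization I.rlp.llp I.rlp)⟩
  have : MorphismProperty.IsWeakFactorizationSystem (trivialCofibrations E) (fibrations E) := by
    rw [htc]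
    exact ⟨MorphismProperty.rlp_llp_rlp _, rfl,
      inferInstanceAs (MorphismProperty.HasFactorization J.rlp.llp J.rlp)⟩
  have : (weakEquivalences E).HasTwoOutOfThreeProperty := ‹W.HasTwoOutOfThreeProperty›
  refine ⟨ModelCategory.mk' E, rfl, rfl, ?_, ?_⟩
  · change (trivialCofibrations E).HasFunctorialFactorization (fibrations E)
    rw [htc]
    exact ‹J.rlp.llp.HasFunctorialFactorization J.rlp›
  · change (cofibrations E).HasFunctorialFactorization (trivialFibrations E)
    rw [htf]
    exact ‹I.rlp.llp.HasFunctorialFactorization I.rlp›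

end Existence

section Relative

variable {S : Type u} [Category.{w} S] [ModelCategory S] {C : Type w} [SmallCategory C]

instance (D : ObjectProperty C) : (relWeakEquivalences S D).HasTwoOutOfThreeProperty where
  comp_mem f g hf hg d hd := by
    have := hf d hd
    have := hg d hd
    rw [NatTrans.comp_app]
    infer_instance
  of_postcomp f g hg hfg d hd := by
    have := hg d hd
    have := hfg d hd
    rw [NatTrans.comp_app] at this
    exact weakEquivalence_of_postcomp _ (g.app d)
  of_precomp f g hf hfg d hd := by
    have := hf d hd
    have := hfg d hd
    rw [NatTrans.comp_app] at this
    exact weakEquivalence_of_precomp (f.app d) _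

/-- The morphisms with the left lifting property against the `D`-fibrations are trivial cofibrations
at every object of `C`: evaluation at `d` is left adjoint to `x ↦ ∏_{C(-, d)} x`, which takes
fibrations to objectwise fibrations. -/
lemma llp_relFibrations_app [HasLimits S] (D : ObjectProperty C) {F G : C ⥤ S} (φ : F ⟶ G)
    (hφ : (relFibrations S D).llp φ) (d : C) : trivialCofibrations S (φ.app d) := by
  rw [← MorphismProperty.llp_eq_of_wfs (trivialCofibrations S) (fibrations S)]
  intro x y p hp
  refine ((evaluationAdjunctionLeft S d).hasLiftingProperty_iff φ p).2 (hφ _ fun d' _ => ?_)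
  rw [fibration_iff]
  have : (fibrations S).IsStableUnderProductsOfShape (d' ⟶ d) := by
    rw [← MorphismProperty.rlp_eq_of_wfs (trivialCofibrations S) (fibrations S)]
    infer_instance
  have h : fibrations S (Limits.Pi.map fun _ : d' ⟶ d => p) :=
    MorphismProperty.limMap _ fun _ => hp
  have e : ((evaluationRightAdjoint S d).map p).app d' = Limits.Pi.map fun _ : d' ⟶ d => p :=
    Pi.hom_ext _ _ fun g =>
      (limit.lift_π _ _).trans (Limits.Pi.map_π (fun _ : d' ⟶ d => p) g).symm
  rwa [e]

theorem exists_relativeModelStructure [HasLimits S] [HasColimits S]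
    (hS : IsCofibrantlyGenerated S) (D : ObjectProperty C) :
    ∃ M : ModelCategory (C ⥤ S), IsRelativeModelStructure M D := by
  obtain ⟨I, J, hI, hJ, hIfib, hJfib⟩ := hS
  have := hasSmallObjectArgument_freeCells I hI D
  have := hasSmallObjectArgument_freeCells J hJ D
  have hJ' : (freeCells J D).rlp = relFibrations S D := by
    ext F G p
    simp only [rlp_freeCells, ← hJfib, ← fibration_iff, relFibrations]
  have hI' : (freeCells I D).rlp = (freeCells J D).rlp ⊓ relWeakEquivalences S D := by
    ext F G p
    rw [hJ', rlp_freeCells, ← hIfib]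
    simp only [mem_trivialFibrations_iff]
    exact forall₂_and
  have hW : (freeCells J D).rlp.llp ≤ relWeakEquivalences S D := by
    rw [hJ']
    intro F G φ hφ d _
    exact (weakEquivalence_iff _).2 (llp_relFibrations_app D φ hφ d).2
  obtain ⟨M, hMW, hMfib, h₁, h₂⟩ := exists_modelCategory (relWeakEquivalences S D)
    (freeCells I D) (freeCells J D) hI' hW
  exact ⟨M, hMW, hMfib.trans hJ', h₁, h₂⟩

end Relative

/-! ### The tensor product adjunction -/

section Adj

variable {S₁ : Type u₁} {S₂ : Type u₂} {S₃ : Type u₃}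
  [Category.{w} S₁] [Category.{w} S₂] [Category.{w} S₃]
  {A : Type w} [SmallCategory A] {C : Type w} [SmallCategory C]
  [HasColimits S₃] {T : S₁ ⥤ S₂ ⥤ S₃} {R : S₂ᵒᵖ ⥤ S₃ ⥤ S₁}

/-- The functor `z ↦ R(Y(-), z)`, right adjoint to `(-) ⊗_A Y`. -/
def mapOver (R : S₂ᵒᵖ ⥤ S₃ ⥤ S₁) (Y : A ⥤ S₂) : S₃ ⥤ Aᵒᵖ ⥤ S₁ :=
  R.flip ⋙ (Functor.whiskeringLeft Aᵒᵖ S₂ᵒᵖ S₁).obj Y.op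

/-- The structure map `X(a) ⊙ Y(a) ⟶ X ⊗_A Y`. -/
noncomputable def inclOver (T : S₁ ⥤ S₂ ⥤ S₃) (Y : A ⥤ S₂) (X : Aᵒᵖ ⥤ S₁) (a : A) :
    (T.obj (X.obj (op a))).obj (Y.obj a) ⟶ (tensorOver T Y).obj X :=
  Sigma.ι (fun a : A => (T.obj (X.obj (op a))).obj (Y.obj a)) a ≫
    coequalizer.π (actLeft T Y X) (actRight T Y X)

lemma tensorOver_hom_ext {Y : A ⥤ S₂} {X : Aᵒᵖ ⥤ S₁} {z : S₃} {f g : (tensorOver T Y).obj X ⟶ z}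
    (h : ∀ a, inclOver T Y X a ≫ f = inclOver T Y X a ≫ g) : f = g :=
  coequalizer.hom_ext (Sigma.hom_ext _ _ fun a =>
    (Category.assoc _ _ _).symm.trans ((h a).trans (Category.assoc _ _ _)))

variable (adj : T.flip ⊣₂ R) (Y : A ⥤ S₂)

lemma inclOver_dinatural (X : Aᵒᵖ ⥤ S₁) {a a' : A} (α : a ⟶ a') :
    (T.map (X.map α.op)).app (Y.obj a) ≫ inclOver T Y X a =
      (T.obj (X.obj (op a'))).map (Y.map α) ≫ inclOver T Y X a' := by
  let ι := Sigma.ι (fun α : Arrow A => (T.obj (X.obj (op α.right))).obj (Y.obj α.left))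
    (Arrow.mk α)
  have h₁ : ι ≫ actLeft T Y X = (T.map (X.map α.op)).app (Y.obj a) ≫
      Sigma.ι (fun a : A => (T.obj (X.obj (op a))).obj (Y.obj a)) a :=
    Sigma.ι_desc _ (Arrow.mk α)
  have h₂ : ι ≫ actRight T Y X = (T.obj (X.obj (op a'))).map (Y.map α) ≫
      Sigma.ι (fun a : A => (T.obj (X.obj (op a))).obj (Y.obj a)) a' :=
    Sigma.ι_desc _ (Arrow.mk α)
  have h := ι ≫= coequalizer.condition (actLeft T Y X) (actRight T Y X)
  rw [reassoc_of% h₁, reassoc_of% h₂] at h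
  exact h

lemma inclOver_map {X X' : Aᵒᵖ ⥤ S₁} (τ : X ⟶ X') (a : A) :
    inclOver T Y X a ≫ (tensorOver T Y).map τ =
      (T.map (τ.app (op a))).app (Y.obj a) ≫ inclOver T Y X' a := by
  have h : Sigma.ι (fun a : A => (T.obj (X.obj (op a))).obj (Y.obj a)) a ≫ objCoprodMap T Y τ =
      (T.map (τ.app (op a))).app (Y.obj a) ≫
        Sigma.ι (fun a : A => (T.obj (X'.obj (op a))).obj (Y.obj a)) a :=
    Limits.Sigma.ι_map (fun a : A => (T.map (τ.app (op a))).app (Y.obj a)) a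
  exact (Category.assoc _ _ _).trans ((congrArg _ (coequalizer.π_desc _ _)).trans
    ((Category.assoc _ _ _).symm.trans ((congrArg (· ≫ _) h).trans (Category.assoc _ _ _))))

/-- A dinatural family of maps `X(a) ⊙ Y(a) ⟶ z` induces a map `X ⊗_A Y ⟶ z`. -/
noncomputable def descOver {X : Aᵒᵖ ⥤ S₁} {z : S₃}
    (f : ∀ a, (T.obj (X.obj (op a))).obj (Y.obj a) ⟶ z)
    (hf : ∀ {a a' : A} (α : a ⟶ a'), (T.map (X.map α.op)).app (Y.obj a) ≫ f a =
      (T.obj (X.obj (op a'))).map (Y.map α) ≫ f a') : (tensorOver T Y).obj X ⟶ z :=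
  coequalizer.desc (Sigma.desc f) (by
    apply Sigma.hom_ext
    intro α
    simpa [actLeft, actRight] using hf α.hom)

lemma inclOver_descOver {X : Aᵒᵖ ⥤ S₁} {z : S₃}
    (f : ∀ a, (T.obj (X.obj (op a))).obj (Y.obj a) ⟶ z)
    (hf : ∀ {a a' : A} (α : a ⟶ a'), (T.map (X.map α.op)).app (Y.obj a) ≫ f a =
      (T.obj (X.obj (op a'))).map (Y.map α) ≫ f a') (a : A) :
    inclOver T Y X a ≫ descOver Y f hf = f a :=
  (Category.assoc _ _ _).trans
    ((congrArg _ (coequalizer.π_desc _ _)).trans (Sigma.ι_desc f a))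

omit [HasColimits S₃] in
/-- Families `X(a) ⊙ Y(a) ⟶ z` are dinatural exactly when the adjoint maps `X(a) ⟶ R(Y(a), z)` are
natural. -/
lemma dinatural_iff (X : Aᵒᵖ ⥤ S₁) (z : S₃) {a a' : A} (α : a ⟶ a')
    (f : (T.obj (X.obj (op a))).obj (Y.obj a) ⟶ z)
    (f' : (T.obj (X.obj (op a'))).obj (Y.obj a') ⟶ z) :
    (T.map (X.map α.op)).app (Y.obj a) ≫ f = (T.obj (X.obj (op a'))).map (Y.map α) ≫ f' ↔
      X.map α.op ≫ adj.homEquiv (X₁ := Y.obj a) (X₂ := X.obj (op a)) f =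
        adj.homEquiv (X₁ := Y.obj a') (X₂ := X.obj (op a')) f' ≫
          (R.map (Y.map α).op).app z := by
  rw [← adj.homEquiv_naturality_two, ← adj.homEquiv_naturality_one, EmbeddingLike.apply_eq_iff_eq]
  rfl

/-- The bijection between maps `X ⊗_A Y ⟶ z` and natural transformations `X ⟶ R(Y(-), z)`. -/
noncomputable def tensorOverHomEquiv (X : Aᵒᵖ ⥤ S₁) (z : S₃) :
    ((tensorOver T Y).obj X ⟶ z) ≃ (X ⟶ (mapOver R Y).obj z) where
  toFun f :=
    { app a := adj.homEquiv (X₁ := Y.obj a.unop) (X₂ := X.obj a) (inclOver T Y X a.unop ≫ f)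
      naturality a a' α := by
        refine (dinatural_iff adj Y X z α.unop _ _).1 ?_
        rw [← Category.assoc, inclOver_dinatural, Category.assoc] }
  invFun g := descOver Y
    (fun a => (adj.homEquiv (X₁ := Y.obj a) (X₂ := X.obj (op a))).symm (g.app (op a)))
    (fun {a a'} α => (dinatural_iff adj Y X z α _ _).2
      ((congrArg (X.map α.op ≫ ·) (Equiv.apply_symm_apply _ _)).trans
        ((g.naturality α.op).trans
          (congrArg (· ≫ (R.map (Y.map α).op).app z) (Equiv.apply_symm_apply _ _).symm))))
  left_inv f := tensorOver_hom_ext fun a =>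
    (inclOver_descOver Y _ _ a).trans (Equiv.symm_apply_apply _ _)
  right_inv g := by
    ext a
    exact (congrArg (adj.homEquiv (X₁ := Y.obj a.unop) (X₂ := X.obj a))
      (inclOver_descOver Y _ _ a.unop)).trans (Equiv.apply_symm_apply _ _)

/-- The adjunction between `(-) ⊗_A Y` and `R(Y(-), -)`. -/
noncomputable def tensorOverAdjunction : tensorOver T Y ⊣ mapOver R Y :=
  Adjunction.mkOfHomEquiv
    { homEquiv := tensorOverHomEquiv adj Y
      homEquiv_naturality_left_symm := fun {X X' z} τ g => by
        rw [Equiv.symm_apply_eq]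
        ext a
        refine Eq.trans (congrArg (τ.app a ≫ ·)
          (NatTrans.congr_app ((tensorOverHomEquiv adj Y X' z).apply_symm_apply g) a).symm) ?_
        refine (adj.homEquiv_naturality_two (τ.app a) _).symm.trans (congrArg _ ?_)
        exact ((Category.assoc _ _ _).symm.trans
          ((congrArg (· ≫ _) (inclOver_map Y τ a.unop)).trans (Category.assoc _ _ _))).symm
      homEquiv_naturality_right := fun {X z z'} f q => by
        ext a
        exact (congrArg _ (Category.assoc _ _ _).symm).trans
          (adj.homEquiv_naturality_three q _) }

/-- The adjunction between `(-) ⊗_{C,A} Y` and `R_⊗(Y, -)`, obtained from `tensorOverAdjunction` by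
postcomposition, under the identification of `S₁^(A^op × C)` with `(S₁^(A^op))^C`. -/
noncomputable def biTensorAdjunction : biTensor (C := C) T Y ⊣ biMap R Y :=
  ((Functor.currying (C := Aᵒᵖ) (D := C) (E := S₁)).symm.toAdjunction.comp
    ((Functor.flipping (C := Aᵒᵖ) (D := C) (E := S₁)).toAdjunction.comp
      ((tensorOverAdjunction adj Y).whiskerRight C))).ofNatIsoRight
    (NatIso.ofComponents (fun Z => NatIso.ofComponents (fun x => Iso.refl _) (fun f =>
        (Category.comp_id _).trans (Category.id_comp _).symm))
      (fun q => by
        ext x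
        exact (Category.comp_id _).trans (Category.id_comp _).symm))

end Adj

/-! ### Quillen adjunctions and the corner map -/

section Quillen

variable {M : Type u₁} {N : Type u₂} [Category.{w} M] [Category.{w} N]
    [ModelCategory M] [ModelCategory N] {F : M ⥤ N} {G : N ⥤ M} {adj : F ⊣ G}

lemma isQuillenAdjunction_of_rightAdjoint (adj : F ⊣ G)
    (h : ∀ ⦃X Y : N⦄ (f : X ⟶ Y), fibrations N f → fibrations M (G.map f))
    (h' : ∀ ⦃X Y : N⦄ (f : X ⟶ Y), trivialFibrations N f → trivialFibrations M (G.map f)) :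
    IsQuillenAdjunction adj where
  map_fibration := h
  map_trivialFibration := h'
  map_cofibration X Y f hf := by
    rw [← MorphismProperty.llp_eq_of_wfs (cofibrations N) (trivialFibrations N)]
    intro _ _ p hp
    exact (adj.hasLiftingProperty_iff f p).2
      (MorphismProperty.hasLiftingProperty_of_wfs f (G.map p) hf (h' p hp))
  map_trivialCofibration X Y f hf := by
    rw [← MorphismProperty.llp_eq_of_wfs (trivialCofibrations N) (fibrations N)]
    intro _ _ p hp
    exact (adj.hasLiftingProperty_iff f p).2
      (MorphismProperty.hasLiftingProperty_of_wfs f (G.map p) hf (h p hp))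

lemma IsQuillenAdjunction.isCofibrant_obj (h : IsQuillenAdjunction adj) (X : M) [IsCofibrant X] :
    IsCofibrant (F.obj X) := by
  have := adj.leftAdjoint_preservesColimits
  have hi : IsInitial (F.obj (⊥_ M)) := IsInitial.isInitialObj F _ initialIsInitial
  rw [isCofibrant_iff_of_isInitial (F.map (initial.to X)) hi, cofibration_iff]
  exact h.map_cofibration _ (mem_cofibrations _)

/-- Ken Brown's lemma for left Quillen functors. -/
lemma IsQuillenAdjunction.weakEquivalence_map (h : IsQuillenAdjunction adj) {X Y : M} (f : X ⟶ Y)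
    [IsCofibrant X] [IsCofibrant Y] [WeakEquivalence f] : WeakEquivalence (F.map f) := by
  have key {A B : M} (i : A ⟶ B) [Cofibration i] [WeakEquivalence i] :
      WeakEquivalence (F.map i) :=
    (weakEquivalence_iff _).2 (h.map_trivialCofibration i (mem_trivialCofibrations i)).2
  let b : CofibrantBrownFactorization f := Classical.arbitrary _
  have : Cofibration b.i := (cofibration_iff _).2 b.hi
  have := key b.i
  have := key b.s
  have : WeakEquivalence (F.map b.p) :=
    weakEquivalence_of_precomp_of_fac (f := F.map b.s) (fg := 𝟙 _) (by
      rw [← F.map_comp, b.s_p, F.map_id])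
  rw [← b.fac, F.map_comp]
  infer_instance

end Quillen

section Corner

variable {S₁ : Type u₁} {S₂ : Type u₂} {S₃ : Type u₃}
  [Category.{w} S₁] [Category.{w} S₂] [Category.{w} S₃]

/-- If `x ⊙ y` is initial for all `x`, then `R(y, z)` is terminal for all `z`. -/
noncomputable def isTerminalMapping {T : S₁ ⥤ S₂ ⥤ S₃} {R : S₂ᵒᵖ ⥤ S₃ ⥤ S₁} (adj : T.flip ⊣₂ R)
    {y : S₂} (h : ∀ x : S₁, Nonempty (IsInitial ((T.obj x).obj y))) (z : S₃) :
    IsTerminal ((R.obj (op y)).obj z) :=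
  IsTerminal.ofUniqueHom (fun x => adj.homEquiv (X₁ := y) ((h x).some.to z)) fun x _ =>
    ((adj.homEquiv (X₁ := y) (X₂ := x)).symm_apply_eq).1 ((h x).some.hom_ext _ _)

/-- If the functor `R(y, -)` has terminal values, the corner map of `i : y ⟶ y'` and `p : z ⟶ z'` is
isomorphic to `R(y', p)`. -/
lemma pullbackObjObj_π_iff {R : S₂ᵒᵖ ⥤ S₃ ⥤ S₁} {y y' : S₂} {i : y ⟶ y'} {z z' : S₃} {p : z ⟶ z'}
    (sq : R.PullbackObjObj i p) (h : ∀ z, IsTerminal ((R.obj (op y)).obj z))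
    (W : MorphismProperty S₁) [W.RespectsIso] : W sq.π ↔ W ((R.obj (op y')).map p) := by
  have : IsIso ((R.obj (op y)).map p) := isIso_of_isTerminal (h z) (h z') _
  have : IsIso sq.snd := sq.isPullback.isIso_snd_of_isIso
  rw [← sq.π_snd, W.cancel_right_of_respectsIso]

variable [ModelCategory S₁] [ModelCategory S₂] [ModelCategory S₃]
  {R : S₂ᵒᵖ ⥤ S₃ ⥤ S₁} (hR : CornerMapProperty R)
  (h : ∀ z, IsTerminal ((R.obj (op (⊥_ S₂))).obj z)) (y : S₂) [IsCofibrant y]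
  {z z' : S₃} (p : z ⟶ z')
include hR h

lemma CornerMapProperty.map_fibration [Fibration p] : Fibration ((R.obj (op y)).map p) :=
  (fibration_iff _).2 ((pullbackObjObj_π_iff _ h _).1
    (hR (initial.to y) p (mem_cofibrations _) (mem_fibrations p)).1)

lemma CornerMapProperty.map_weakEquivalence [Fibration p] [WeakEquivalence p] :
    WeakEquivalence ((R.obj (op y)).map p) := by
  have := (hR (initial.to y) p (mem_cofibrations _) (mem_fibrations p)).2
    (.inr (mem_weakEquivalences p))
  exact (weakEquivalence_iff _).2 ((pullbackObjObj_π_iff _ h _).1 this.2)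

end Corner

end DiagramCoupling

theorem theorem4p4
    {S₁ : Type u₁} {S₂ : Type u₂} {S₃ : Type u₃}
    [Category.{w} S₁] [Category.{w} S₂] [Category.{w} S₃]
    [HasLimits S₁] [HasColimits S₁] [HasLimits S₂] [HasColimits S₂] [HasLimits S₃] [HasColimits S₃]
    [ModelCategory S₁] [ModelCategory S₂] [ModelCategory S₃]
    (hS₁ : DiagramCoupling.IsCofibrantlyGenerated S₁)
    (hS₂ : DiagramCoupling.IsCofibrantlyGenerated S₂)
    (hS₃ : DiagramCoupling.IsCofibrantlyGenerated S₃)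
    -- a right tensorial coupling `T : S₁ × S₂ → S₃` with right mapping functor `R`
    (T : S₁ ⥤ S₂ ⥤ S₃) (R : S₂ᵒᵖ ⥤ S₃ ⥤ S₁) (adj : T.flip ⊣₂ R)
    (hcorner : DiagramCoupling.CornerMapProperty R)
    -- `x ⊙ ∅` is an initial object for every `x`
    (hinit : ∀ x : S₁, Nonempty (IsInitial ((T.obj x).obj (⊥_ S₂))))
    {A C : Type w} [SmallCategory A] [SmallCategory C]
    -- the objects of the subcategory `D` of `C`
    (D : ObjectProperty C)
    (Y : A ⥤ S₂) (hY : ∀ a : A, IsCofibrant (Y.obj a)) :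
    ∃ (M₁ : ModelCategory (Aᵒᵖ × C ⥤ S₁)) (M₃ : ModelCategory (C ⥤ S₃))
      (adjY : DiagramCoupling.biTensor (C := C) T Y ⊣ DiagramCoupling.biMap R Y),
      DiagramCoupling.IsRelativeModelStructure M₁ (DiagramCoupling.opProd A D) ∧
      DiagramCoupling.IsRelativeModelStructure M₃ D ∧
      DiagramCoupling.IsQuillenAdjunction adjY ∧
      ∀ ⦃X X' : Aᵒᵖ × C ⥤ S₁⦄ (ξ : X ⟶ X'), IsCofibrant X → IsCofibrant X' →
        DiagramCoupling.relWeakEquivalences S₁ (DiagramCoupling.opProd A D) ξ →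
          IsCofibrant ((DiagramCoupling.biTensor T Y).obj X) ∧
          IsCofibrant ((DiagramCoupling.biTensor T Y).obj X') ∧
          DiagramCoupling.relWeakEquivalences S₃ D ((DiagramCoupling.biTensor T Y).map ξ) := by
  obtain ⟨M₁, h₁⟩ := DiagramCoupling.exists_relativeModelStructure hS₁ (DiagramCoupling.opProd A D)
  obtain ⟨M₃, h₃⟩ := DiagramCoupling.exists_relativeModelStructure hS₃ D
  have hterm := DiagramCoupling.isTerminalMapping adj hinit
  have hQ : DiagramCoupling.IsQuillenAdjunction
      (DiagramCoupling.biTensorAdjunction (C := C) adj Y) := by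
    refine DiagramCoupling.isQuillenAdjunction_of_rightAdjoint _ ?_ ?_
    · rw [h₁.fibrations_eq, h₃.fibrations_eq]
      intro Z Z' q hq x hx
      have := hq x.2 hx
      exact hcorner.map_fibration hterm (Y.obj x.1.unop) (q.app x.2)
    · rw [trivialFibrations, trivialFibrations, h₁.fibrations_eq, h₃.fibrations_eq,
        h₁.weakEquivalences_eq, h₃.weakEquivalences_eq]
      intro Z Z' q hq
      refine ⟨fun x hx => ?_, fun x hx => ?_⟩
      all_goals
        have := hq.1 x.2 hx
        have := hq.2 x.2 hx
      · exact hcorner.map_fibration hterm (Y.obj x.1.unop) (q.app x.2)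
      · exact hcorner.map_weakEquivalence hterm (Y.obj x.1.unop) (q.app x.2)
  refine ⟨M₁, M₃, DiagramCoupling.biTensorAdjunction adj Y, h₁, h₃, hQ, fun X X' ξ _ _ hξ => ?_⟩
  rw [← h₁.weakEquivalences_eq, ← weakEquivalence_iff] at hξ
  rw [← h₃.weakEquivalences_eq, ← weakEquivalence_iff]
  exact ⟨hQ.isCofibrant_obj X, hQ.isCofibrant_obj X', hQ.weakEquivalence_map ξ⟩
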